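/- Let $\mathbf{SmCat}$ be the category of small categories with the Joyal–Tierney (canonical) model structure: the cofibrations are the functors injective on objects, the weak equivalences are the equivalences of categories, and the fibrations are the isofibrations (every isomorphism $F(x)\cong y$ lifts to an isomorphism with source $x$). Write $1$ for the terminal category. A homotopy pushout of $Y \leftarrow X \to Z$ is a pushout of some diagram $\tilde Y \leftarrow \tilde X \to \tilde Z$ of two cofibrations with $\tilde X$ cofibrant, which maps to $Y\leftarrow X\to Z$ by acyclic fibrations. A one-sided homotopy pushout of $f:X\to Z$ along $g:X\to Y$, with $X$ cofibrant, is a pushout $W$ of $\tilde Y \leftarrow X \xrightarrow{f} Z$ for some factorization of $g$ as a cofibration $X\to\tilde Y$ followed by an acyclic fibration $\tilde Y\to Y$; it comes with a canonical map $Z\to W$. The $0$-sphere is $1\amalg 1$, and for $n\ge 1$ an $n$-sphere is a homotopy pushout of $1\leftarrow Y\to 1$ with $Y$ an $(n-1)$-sphere. A $0$-dimensional CW-complex is a cofibrant object that is a coproduct of copies of $1$. For $n\ge 1$ an $n$-dimensional CW-complex is a one-sided homotopy pushout $X$ of a map $\coprod_{i\in I}S_i\to Y$ along $\coprod_{i\in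 I}S_i\to\coprod_{i\in I}1$, where $I$ is a set, each $S_i$ is an $(n-1)$-sphere, and $Y$ is an $(n-1)$-dimensional CW-complex; the resulting map $Y\to X$ is called an $(n-1)$-skeleton inclusion. A finite-dimensional CW-complex is an $n$-dimensional CW-complex for some $n\ge 0$. A CW-complex of possibly infinite dimension is a cofibrant object weakly equivalent (i.e. connected by a finite zigzag of weak equivalences) to the colimit of a sequence $X_0\to X_1\to X_2\to\cdots$ in which each $X_n$ is an $n$-dimensional CW-complex and each $X_n\to X_{n+1}$ is an $n$-skeleton inclusion. Theorem. The full subcategory of $\mathbf{SmCat}$ spanned by the CW-complexes is the full subcategory spanned by the groupoids. This holds for each of the following meanings of "CW-complex": the finite-dimensional CW-complexes; the small categories weakly equivalent to a finite-dimensional CW-complex; the CW-complexes of possibly infinite dimension. That is, for a small category each of these three conditions is equivalent to being a groupoid. -/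

import Mathlib

open CategoryTheory CategoryTheory.Limits HomotopicalAlgebra

universe w u

namespace ModelCW

section General

variable {C : Type u} [Category.{w} C] [HasTerminal C] [HasColimits C]
  [CategoryWithCofibrations C] [CategoryWithFibrations C] [CategoryWithWeakEquivalences C]

/-- `W` is a homotopy pushout of `Y ← X → Z` (legs `g : X ⟶ Y` and `f : X ⟶ Z`): there are acyclic
fibrations `pX : X' ⟶ X`, `pY : Y' ⟶ Y`, `pZ : Z' ⟶ Z` and cofibrations `a : X' ⟶ Z'`,
`b : X' ⟶ Y'` lying over `f` and `g`, with `X'` cofibrant, such that `W` is a pushout of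
`Y' ← X' → Z'`. -/
def IsHomotopyPushout {X Y Z : C} (f : X ⟶ Z) (g : X ⟶ Y) (W : C) : Prop :=
  ∃ (X' Y' Z' : C) (a : X' ⟶ Z') (b : X' ⟶ Y')
    (pX : X' ⟶ X) (pY : Y' ⟶ Y) (pZ : Z' ⟶ Z) (inl : Z' ⟶ W) (inr : Y' ⟶ W),
    a ≫ pZ = pX ≫ f ∧ b ≫ pY = pX ≫ g ∧
    trivialFibrations C pX ∧ trivialFibrations C pY ∧ trivialFibrations C pZ ∧
    cofibrations C a ∧ cofibrations C b ∧ IsCofibrant X' ∧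
    IsPushout a b inl inr

/-- The object `W`, together with the map `ι : Z ⟶ W`, is a one-sided homotopy pushout of
`f : X ⟶ Z` along `g : X ⟶ Y`: the object `X` is cofibrant, `g` factors as a cofibration
`i : X ⟶ Y'` followed by an acyclic fibration `p : Y' ⟶ Y`, and `W` is a pushout of
`Y' ← X → Z`, with `ι` as the canonical map from `Z`. -/
def IsOneSidedHomotopyPushout {X Y Z W : C} (f : X ⟶ Z) (g : X ⟶ Y) (ι : Z ⟶ W) : Prop :=
  IsCofibrant X ∧
  ∃ (Y' : C) (i : X ⟶ Y') (p : Y' ⟶ Y) (j : Y' ⟶ W),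
    i ≫ p = g ∧ cofibrations C i ∧ trivialFibrations C p ∧ IsPushout f i ι j

/-- The `n`-spheres: the `0`-sphere is `1 ⨿ 1`, and an `(n + 1)`-sphere is a homotopy pushout of
`1 ← Y → 1` with `Y` an `n`-sphere. -/
def IsSphere : ℕ → C → Prop
  | 0, X => Nonempty (X ≅ (⊤_ C) ⨿ (⊤_ C))
  | n + 1, X => ∃ Y : C, IsSphere n Y ∧
      IsHomotopyPushout (terminal.from Y) (terminal.from Y) X

/-- The map `ι : Y ⟶ X` attaches a set of `(n + 1)`-cells to `Y` along `n`-spheres: it is the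
canonical map of a one-sided homotopy pushout of some map `∐ S i ⟶ Y` along
`∐ S i ⟶ ∐ 1`, where each `S i` is an `n`-sphere. When `Y` is an `n`-dimensional CW-complex, this
says that `ι` is an `n`-skeleton inclusion. -/
def AttachesCells (n : ℕ) {Y X : C} (ι : Y ⟶ X) : Prop :=
  ∃ (I : Type w) (S : I → C) (f : (∐ S) ⟶ Y), (∀ i, IsSphere n (S i)) ∧
    IsOneSidedHomotopyPushout f
      (Limits.Sigma.map (fun i => terminal.from (S i)) : (∐ S) ⟶ ∐ fun _ : I => ⊤_ C) ι

/-- The `n`-dimensional CW-complexes. -/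
def IsCWComplexOfDim : ℕ → C → Prop
  | 0, X => IsCofibrant X ∧ ∃ I : Type w, Nonempty (X ≅ ∐ fun _ : I => ⊤_ C)
  | n + 1, X => ∃ (Y : C) (ι : Y ⟶ X), IsCWComplexOfDim n Y ∧ AttachesCells n ι

/-- Two objects are weakly equivalent if a finite zigzag of weak equivalences connects them. -/
def WeaklyEquivalent (X Y : C) : Prop :=
  Relation.EqvGen (fun A B : C => ∃ f : A ⟶ B, weakEquivalences C f) X Y

variable (C)

/-- The finite-dimensional CW-complexes. -/
def finiteDimCWComplexes : ObjectProperty C :=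
  fun X => ∃ n : ℕ, IsCWComplexOfDim n X

/-- The objects weakly equivalent to a finite-dimensional CW-complex. -/
def finiteDimCWTypes : ObjectProperty C :=
  fun X => ∃ Y : C, finiteDimCWComplexes C Y ∧ WeaklyEquivalent X Y

/-- The CW-complexes, of possibly infinite dimension: the cofibrant objects weakly equivalent to
the colimit of a sequence `X₀ ⟶ X₁ ⟶ ⋯` of skeleton inclusions, with `Xₙ` an `n`-dimensional
CW-complex. -/
def cwComplexes : ObjectProperty C :=
  fun X => IsCofibrant X ∧ ∃ F : ℕ ⥤ C,
    (∀ n, IsCWComplexOfDim n (F.obj n)) ∧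
    (∀ n, AttachesCells n (F.map (homOfLE (Nat.le_succ n)))) ∧
    WeaklyEquivalent X (colimit F)

end General

section SmCat

/-- An isofibration: every isomorphism `F x ≅ y` lifts to an isomorphism out of `x`. -/
def IsIsofibration {A B : Type u} [Category.{u} A] [Category.{u} B] (F : A ⥤ B) : Prop :=
  ∀ (x : A) (y : B) (f : F.obj x ≅ y),
    ∃ (x' : A) (g : x ≅ x') (h : F.obj x' = y), F.map g.hom ≫ eqToHom h = f.hom

/-! The three classes of the Joyal-Tierney model structure on small categories. -/

instance : CategoryWithCofibrations Cat.{u, u} where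
  cofibrations := fun _ _ F => Function.Injective F.toFunctor.obj

instance : CategoryWithWeakEquivalences Cat.{u, u} where
  weakEquivalences := fun _ _ F => F.toFunctor.IsEquivalence

instance : CategoryWithFibrations Cat.{u, u} where
  fibrations := fun _ _ F => IsIsofibration F.toFunctor

/-- The small categories that are groupoids. -/
def groupoids : ObjectProperty Cat.{u, u} :=
  fun X => IsGroupoid X

end SmCat

end ModelCW

namespace ModelCW.SmCat

/-! ### Colimits of groupoids -/

/-! CW-complexes are groupoids because groupoids are closed under colimits in small categories
(`isGroupoid_of_isColimit`: a cocone on groupoids factors through the core of its vertex) and under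
equivalence. Spheres and skeleta are built from the terminal category by colimits and acyclic
fibrations, so they never leave groupoids.

Conversely, every groupoid `G` has a presentation of dimension 2. The objects of `G` are the
0-cells. Attaching one free isomorphism per morphism of `G` gives a groupoid `X` with a functor to
`G` that is full and bijective on objects (`exists_attachesCells_full_bijective`). Such a functor is
the quotient that equates the parallel pairs it identifies, and equating a pair means gluing a
2-cell along a circle with two objects (`attachesCells_of_full_of_bijective`). Every object is
cofibrant, and the two-object indiscrete category `interval` replaces the terminal category in all
cofibrant factorizations, so homotopy pushouts become strict ones. -/

lemma functorToCore_ext {A B : Type*} [Category* A] [Category* B] {F G : A ⥤ Core B}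
    (h : F ⋙ Core.inclusion B = G ⋙ Core.inclusion B) : F = G := by
  have hobj (X : A) : F.obj X = G.obj X :=
    congrArg Core.mk (Functor.congr_obj h X : (F.obj X).of = (G.obj X).of)
  refine CategoryTheory.Functor.ext hobj fun X Y f => ?_
  apply (Core.inclusion B).map_injective
  rw [Functor.map_comp, Functor.map_comp, eqToHom_map, eqToHom_map]
  exact Functor.congr_hom h f

/-- The morphism to the core of `Y` induced by a morphism from a groupoid to `Y`. -/
noncomputable def toCore {X Y : Cat.{u, u}} (hX : IsGroupoid X) (F : X ⟶ Y) :
    X ⟶ Cat.of (Core Y) :=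
  letI : Groupoid X := Groupoid.ofIsGroupoid
  (Core.functorToCore F.toFunctor).toCatHom

/-- The inclusion of the core of `Y`, as a morphism of `Cat`. -/
def coreInclusion (Y : Cat.{u, u}) : Cat.of (Core Y) ⟶ Y :=
  (Core.inclusion Y).toCatHom

lemma toCore_comp_coreInclusion {X Y : Cat.{u, u}} (hX : IsGroupoid X) (F : X ⟶ Y) :
    toCore hX F ≫ coreInclusion Y = F := rfl

instance (Y : Cat.{u, u}) : Mono (coreInclusion Y) where
  right_cancellation _ _ h :=
    Cat.ext (functorToCore_ext (congrArg Cat.Hom.toFunctor h))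

/-- In the category of small categories, a colimit of groupoids is a groupoid. -/
lemma isGroupoid_of_isColimit {J : Type*} [Category* J] {D : J ⥤ Cat.{u, u}} {c : Cocone D}
    (hc : IsColimit c) (hD : ∀ j, IsGroupoid (D.obj j)) : IsGroupoid c.pt := by
  let c' : Cocone D :=
    { pt := Cat.of (Core c.pt)
      ι :=
        { app := fun j => toCore (hD j) (c.ι.app j)
          naturality := fun i j f => by
            rw [← cancel_mono (coreInclusion c.pt)]
            simp [toCore_comp_coreInclusion] } }
  -- The core inclusion has a section, so every morphism of `c.pt` is, up to `eqToHom`, the image of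
  -- a morphism of the core, hence invertible.
  have h : hc.desc c' ≫ coreInclusion c.pt = 𝟙 c.pt := by
    refine hc.hom_ext fun j => ?_
    rw [hc.fac_assoc, Category.comp_id]
    rfl
  refine ⟨fun {x y} f => ?_⟩
  have hf := Functor.congr_hom (congrArg Cat.Hom.toFunctor h) f
  have : IsIso ((hc.desc c' ≫ coreInclusion c.pt).toFunctor.map f) := by
    have hg : ∀ {a b : Core c.pt} (g : a ⟶ b), IsIso ((Core.inclusion c.pt).map g) :=
      fun g => inferInstance
    exact hg ((hc.desc c').toFunctor.map f)
  rw [hf] at this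
  simpa using this

lemma isGroupoid_of_isPushout {X Y Z W : Cat.{u, u}} {f : X ⟶ Y} {g : X ⟶ Z} {h : Y ⟶ W}
    {k : Z ⟶ W} (sq : IsPushout f g h k) (hX : IsGroupoid X) (hY : IsGroupoid Y)
    (hZ : IsGroupoid Z) : IsGroupoid W :=
  isGroupoid_of_isColimit sq.isColimit (by rintro (_ | _ | _) <;> assumption)

lemma isGroupoid_sigma {I : Type u} {A : I → Cat.{u, u}} (hA : ∀ i, IsGroupoid (A i)) :
    IsGroupoid (∐ A : Cat.{u, u}) :=
  isGroupoid_of_isColimit (colimit.isColimit (Discrete.functor A)) fun j => hA j.as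

lemma isGroupoid_coprod {A B : Cat.{u, u}} (hA : IsGroupoid A) (hB : IsGroupoid B) :
    IsGroupoid (A ⨿ B : Cat.{u, u}) :=
  isGroupoid_of_isColimit (colimit.isColimit (pair A B)) (by rintro ⟨_ | _⟩ <;> assumption)

lemma isGroupoid_iff_of_weakEquivalence {X Y : Cat.{u, u}} {F : X ⟶ Y}
    (hF : weakEquivalences Cat.{u, u} F) : IsGroupoid X ↔ IsGroupoid Y := by
  have : F.toFunctor.IsEquivalence := hF
  exact ⟨fun _ => isGroupoid_of_reflects_iso F.toFunctor.inv,
    fun _ => isGroupoid_of_reflects_iso F.toFunctor⟩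

lemma weakEquivalences_of_isIso {X Y : Cat.{u, u}} (F : X ⟶ Y) [IsIso F] :
    weakEquivalences Cat.{u, u} F :=
  (Cat.equivOfIso (asIso F)).isEquivalence_functor

lemma isGroupoid_of_iso {X Y : Cat.{u, u}} (e : X ≅ Y) (hY : IsGroupoid Y) : IsGroupoid X :=
  (isGroupoid_iff_of_weakEquivalence (weakEquivalences_of_isIso e.hom)).2 hY

lemma isGroupoid_iff_of_weaklyEquivalent {X Y : Cat.{u, u}} (h : WeaklyEquivalent X Y) :
    IsGroupoid X ↔ IsGroupoid Y := by
  induction h with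
  | rel X Y h =>
    obtain ⟨F, hF⟩ := h
    exact isGroupoid_iff_of_weakEquivalence hF
  | refl X => rfl
  | symm X Y _ ih => exact ih.symm
  | trans X Y Z _ _ ih₁ ih₂ => exact ih₁.trans ih₂

/-! ### CW-complexes are groupoids -/

lemma isGroupoid_terminal : IsGroupoid (⊤_ Cat.{u, u} : Cat.{u, u}) :=
  isGroupoid_of_iso (terminalIsTerminal.uniqueUpToIso Cat.isTerminalDiscretePUnit)
    (inferInstanceAs (IsGroupoid (Discrete PUnit)))

lemma isGroupoid_of_trivialFibrations {X Y : Cat.{u, u}} {F : X ⟶ Y}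
    (hF : trivialFibrations Cat.{u, u} F) (hY : IsGroupoid Y) : IsGroupoid X :=
  (isGroupoid_iff_of_weakEquivalence hF.2).2 hY

/-- Each replaced vertex is equivalent to a groupoid; the cofibrations and the compatibility squares
play no role. -/
lemma isGroupoid_of_isHomotopyPushout {X Y Z W : Cat.{u, u}} {f : X ⟶ Z} {g : X ⟶ Y}
    (h : IsHomotopyPushout f g W) (hX : IsGroupoid X) (hY : IsGroupoid Y) (hZ : IsGroupoid Z) :
    IsGroupoid W := by
  obtain ⟨X', Y', Z', a, b, pX, pY, pZ, inl, inr, -, -, hpX, hpY, hpZ, -, -, -, sq⟩ := h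
  exact isGroupoid_of_isPushout sq (isGroupoid_of_trivialFibrations hpX hX)
    (isGroupoid_of_trivialFibrations hpZ hZ) (isGroupoid_of_trivialFibrations hpY hY)

lemma isGroupoid_of_isSphere {n : ℕ} {X : Cat.{u, u}} (h : IsSphere n X) : IsGroupoid X := by
  induction n generalizing X with
  | zero =>
    obtain ⟨e⟩ := h
    exact isGroupoid_of_iso e (isGroupoid_coprod isGroupoid_terminal isGroupoid_terminal)
  | succ n ih =>
    obtain ⟨Y, hY, h⟩ := h
    exact isGroupoid_of_isHomotopyPushout h (ih hY) isGroupoid_terminal isGroupoid_terminal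

lemma isGroupoid_of_attachesCells {n : ℕ} {X Y : Cat.{u, u}} {ι : Y ⟶ X}
    (h : AttachesCells n ι) (hY : IsGroupoid Y) : IsGroupoid X := by
  obtain ⟨I, S, f, hS, -, Y', i, p, j, -, -, hp, sq⟩ := h
  exact isGroupoid_of_isPushout sq (isGroupoid_sigma fun i => isGroupoid_of_isSphere (hS i)) hY
    (isGroupoid_of_trivialFibrations hp (isGroupoid_sigma fun _ => isGroupoid_terminal))

lemma isGroupoid_of_isCWComplexOfDim {n : ℕ} {X : Cat.{u, u}} (h : IsCWComplexOfDim n X) :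
    IsGroupoid X := by
  induction n generalizing X with
  | zero =>
    obtain ⟨-, I, ⟨e⟩⟩ := h
    exact isGroupoid_of_iso e (isGroupoid_sigma fun _ => isGroupoid_terminal)
  | succ n ih =>
    obtain ⟨Y, ι, hY, h⟩ := h
    exact isGroupoid_of_attachesCells h (ih hY)

/-! ### Indiscrete categories -/

/-- The category with set of objects `A` and exactly one morphism between any two objects. -/
def indiscrete (A : Type u) : Cat.{u, u} where
  α := A
  str :=
    { Hom _ _ := PUnit
      id _ := ⟨⟩
      comp _ _ := ⟨⟩ }

/-- The morphism to an indiscrete category given by a map on objects. -/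
def toIndiscrete {X : Cat.{u, u}} {A : Type u} (φ : X → A) : X ⟶ indiscrete A where
  toFunctor :=
    { obj := φ
      map _ := ⟨⟩ }

lemma toIndiscrete_ext {X : Cat.{u, u}} {A : Type u} {F G : X ⟶ indiscrete A}
    (h : ∀ x, F.toFunctor.obj x = G.toFunctor.obj x) : F = G :=
  Cat.ext (CategoryTheory.Functor.ext h fun _ _ _ => rfl)

/-- The objects of a colimit of small categories come from the objects of the diagram. -/
lemma exists_of_isColimit {J : Type*} [Category* J] {D : J ⥤ Cat.{u, u}} {c : Cocone D}
    (hc : IsColimit c) (x : c.pt) : ∃ (j : J) (y : D.obj j), (c.ι.app j).toFunctor.obj y = x := by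
  let P (x : c.pt) : Prop := ∃ (j : J) (y : D.obj j), (c.ι.app j).toFunctor.obj y = x
  -- Any map on objects is a functor to an indiscrete category. The predicate `P` and the constant
  -- `True` give two such functors that agree on the whole diagram, hence on the colimit.
  have h : (toIndiscrete fun x => ULift.up (P x)) = toIndiscrete fun _ => ULift.up True := by
    refine hc.hom_ext fun j => toIndiscrete_ext fun y => ?_
    exact congrArg ULift.up (eq_true ⟨j, y, rfl⟩)
  have hx : ULift.up.{u} (P x) = ULift.up True :=
    Functor.congr_obj (congrArg Cat.Hom.toFunctor h) x
  exact of_eq_true (congrArg ULift.down hx)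

lemma exists_sigma_obj {I : Type u} {A : I → Cat.{u, u}} (x : (∐ A : Cat.{u, u})) :
    ∃ (i : I) (y : A i), (Sigma.ι A i).toFunctor.obj y = x := by
  obtain ⟨⟨i⟩, y, hy⟩ := exists_of_isColimit (colimit.isColimit (Discrete.functor A)) x
  exact ⟨i, y, hy⟩

lemma exists_coprod_obj {A B : Cat.{u, u}} (x : (A ⨿ B : Cat.{u, u})) :
    (∃ y : A, (coprod.inl : A ⟶ A ⨿ B).toFunctor.obj y = x) ∨
      ∃ y : B, (coprod.inr : B ⟶ A ⨿ B).toFunctor.obj y = x := by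
  obtain ⟨⟨_ | _⟩, y, hy⟩ := exists_of_isColimit (colimit.isColimit (pair A B)) x
  · exact Or.inl ⟨y, hy⟩
  · exact Or.inr ⟨y, hy⟩

lemma exists_pushout_obj {X Y Z W : Cat.{u, u}} {f : X ⟶ Y} {g : X ⟶ Z} {h : Y ⟶ W} {k : Z ⟶ W}
    (sq : IsPushout f g h k) (w : W) :
    (∃ y, h.toFunctor.obj y = w) ∨ ∃ z, k.toFunctor.obj z = w := by
  obtain ⟨_ | _ | _, y, hy⟩ := exists_of_isColimit sq.isColimit w
  · refine Or.inl ⟨f.toFunctor.obj y, ?_⟩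
    rw [← hy]
    exact Functor.congr_obj (congrArg Cat.Hom.toFunctor
      (sq.cocone.w WalkingSpan.Hom.fst)) y
  · exact Or.inl ⟨y, hy⟩
  · exact Or.inr ⟨y, hy⟩

/-- A pushout of a morphism that is surjective on objects is surjective on objects. -/
lemma surjective_of_isPushout {X Y Z W : Cat.{u, u}} {f : X ⟶ Y} {g : X ⟶ Z} {h : Y ⟶ W}
    {k : Z ⟶ W} (sq : IsPushout f g h k) (hg : Function.Surjective g.toFunctor.obj) :
    Function.Surjective h.toFunctor.obj := by
  intro w
  obtain h | ⟨z, rfl⟩ := exists_pushout_obj sq w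
  · exact h
  · obtain ⟨x, rfl⟩ := hg z
    exact ⟨f.toFunctor.obj x, by simp only [← Cat.Hom.comp_obj, sq.w]⟩

/-! ### Cofibrations and acyclic fibrations -/

lemma isEmpty_initial : IsEmpty (⊥_ Cat.{u, u} : Cat.{u, u}) :=
  ⟨fun x => ((initial.to (indiscrete PEmpty.{u + 1})).toFunctor.obj x).elim⟩

lemma isCofibrant (X : Cat.{u, u}) : IsCofibrant X :=
  ⟨fun x => (isEmpty_initial.false x).elim⟩

lemma trivialFibrations_of_surjective {X Y : Cat.{u, u}} (F : X ⟶ Y) [F.toFunctor.Full]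
    [F.toFunctor.Faithful] (hF : Function.Surjective F.toFunctor.obj) :
    trivialFibrations Cat.{u, u} F := by
  refine ⟨fun x y f => ?_, ?_⟩
  · obtain ⟨x', rfl⟩ := hF y
    exact ⟨x', F.toFunctor.preimageIso f, rfl, by simp⟩
  · have : F.toFunctor.EssSurj := ⟨fun y => (hF y).imp fun x hx => ⟨eqToIso hx⟩⟩
    exact { }

lemma bijective_obj_of_isIso {X Y : Cat.{u, u}} (F : X ⟶ Y) [IsIso F] :
    Function.Bijective F.toFunctor.obj := by
  have h : IsIso (Cat.objects.map F) := inferInstance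
  exact (isIso_iff_bijective _).1 h

lemma trivialFibrations_of_isIso {X Y : Cat.{u, u}} (F : X ⟶ Y) [IsIso F] :
    trivialFibrations Cat.{u, u} F := by
  have : F.toFunctor.IsEquivalence := weakEquivalences_of_isIso F
  exact trivialFibrations_of_surjective F (bijective_obj_of_isIso F).2

/-! ### Coproducts of small categories -/

/-- The coproduct of small categories is given by the category structure on the sigma type. -/
def sigmaIsColimit {I : Type u} (A : I → Cat.{u, u}) :
    IsColimit (Cofan.mk (f := A) (Cat.of (Σ i, A i))
      fun i => (Sigma.incl (C := fun i => A i) i).toCatHom) :=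
  Cofan.IsColimit.mk _ (fun s => (Sigma.desc fun i => (s.inj i).toFunctor).toCatHom)
    (fun s i => rfl)
    (fun s m hm => by
      have hm' (i : I) : Sigma.incl i ⋙ m.toFunctor = (s.inj i).toFunctor :=
        congrArg Cat.Hom.toFunctor (hm i)
      refine Cat.ext (CategoryTheory.Functor.ext (fun ⟨i, x⟩ => Functor.congr_obj (hm' i) x) ?_)
      rintro ⟨i, x⟩ ⟨_, y⟩ ⟨f⟩
      exact Functor.congr_hom (hm' i) f)

/-- The comparison isomorphism between the chosen coproduct and the sigma category. -/
noncomputable def sigmaIso {I : Type u} (A : I → Cat.{u, u}) :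
    (∐ A : Cat.{u, u}) ≅ Cat.of (Σ i, A i) :=
  (coproductIsCoproduct A).coconePointUniqueUpToIso (sigmaIsColimit A)

lemma ι_sigmaIso_hom {I : Type u} (A : I → Cat.{u, u}) (i : I) :
    Sigma.ι A i ≫ (sigmaIso A).hom = (Sigma.incl (C := fun i => A i) i).toCatHom :=
  (coproductIsCoproduct A).comp_coconePointUniqueUpToIso_hom (sigmaIsColimit A) ⟨i⟩

/-- The functor between sigma categories induced by a family of functors. -/
def sigmaFunctor {I : Type u} {A B : I → Cat.{u, u}} (φ : ∀ i, A i ⟶ B i) :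
    (Σ i, A i) ⥤ (Σ i, B i) :=
  Sigma.desc fun i => (φ i).toFunctor ⋙ Sigma.incl (C := fun i => B i) i

/-- This reduces questions about objects and morphisms of the chosen coproducts to the explicit
sigma categories. -/
lemma sigmaMap_eq {I : Type u} {A B : I → Cat.{u, u}} (φ : ∀ i, A i ⟶ B i) :
    Limits.Sigma.map φ = (sigmaIso A).hom ≫ (sigmaFunctor φ).toCatHom ≫ (sigmaIso B).inv := by
  refine Sigma.hom_ext _ _ fun i => ?_
  rw [← Category.assoc, ← Category.assoc, Iso.eq_comp_inv, ι_sigmaIso_hom, Sigma.ι_map,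
    Category.assoc, ι_sigmaIso_hom]
  rfl

lemma injective_obj_sigmaMap {I : Type u} {A B : I → Cat.{u, u}} (φ : ∀ i, A i ⟶ B i)
    (hφ : ∀ i, Function.Injective (φ i).toFunctor.obj) :
    Function.Injective (Limits.Sigma.map φ).toFunctor.obj := by
  rw [sigmaMap_eq]
  refine (bijective_obj_of_isIso (sigmaIso B).inv).1.comp (Function.Injective.comp ?_
    (bijective_obj_of_isIso (sigmaIso A).hom).1)
  rintro ⟨i, x⟩ ⟨j, y⟩ h
  obtain ⟨rfl, h⟩ := Sigma.mk.inj_iff.1 h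
  exact congrArg (Sigma.mk i) (hφ i (eq_of_heq h))

lemma exists_sigmaFunctor_map {I : Type u} {A B : I → Cat.{u, u}} (φ : ∀ i, A i ⟶ B i)
    [∀ i, (φ i).toFunctor.Full] {i j : I} {x : A i} {y : A j}
    (f : (sigmaFunctor φ).obj ⟨i, x⟩ ⟶ (sigmaFunctor φ).obj ⟨j, y⟩) :
    ∃ g : (⟨i, x⟩ : Σ i, A i) ⟶ ⟨j, y⟩, (sigmaFunctor φ).map g = f := by
  change Sigma.SigmaHom (⟨i, (φ i).toFunctor.obj x⟩ : Σ i, B i)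
    ⟨j, (φ j).toFunctor.obj y⟩ at f
  -- The target must be a free variable `y'` for the case split on `f`, which forces `i = j`, to go
  -- through.
  have key (y' : B j) (hy : (φ j).toFunctor.obj y = y')
      (f : (⟨i, (φ i).toFunctor.obj x⟩ : Σ i, B i) ⟶ ⟨j, y'⟩) :
      ∃ g : (⟨i, x⟩ : Σ i, A i) ⟶ ⟨j, y⟩,
        (sigmaFunctor φ).map g ≫ eqToHom (congrArg (Sigma.mk j) hy) = f := by
    obtain ⟨f⟩ := f
    subst hy
    obtain ⟨g, rfl⟩ := (φ i).toFunctor.map_surjective f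
    exact ⟨Sigma.SigmaHom.mk g, Category.comp_id _⟩
  obtain ⟨g, hg⟩ := key _ rfl f
  exact ⟨g, (Category.comp_id _).symm.trans hg⟩

lemma trivialFibrations_sigmaMap {I : Type u} {A B : I → Cat.{u, u}} (φ : ∀ i, A i ⟶ B i)
    [∀ i, (φ i).toFunctor.Full] [∀ i, (φ i).toFunctor.Faithful]
    (hφ : ∀ i, Function.Surjective (φ i).toFunctor.obj) :
    trivialFibrations Cat.{u, u} (Limits.Sigma.map φ) := by
  have hA : (sigmaIso A).hom.toFunctor.IsEquivalence := weakEquivalences_of_isIso _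
  have hB : (sigmaIso B).inv.toFunctor.IsEquivalence := weakEquivalences_of_isIso _
  have hfull : (sigmaFunctor φ).toCatHom.toFunctor.Full := ⟨fun {p q} f => by
    obtain ⟨i, x⟩ := p
    obtain ⟨j, y⟩ := q
    exact exists_sigmaFunctor_map φ f⟩
  have hfaithful : (sigmaFunctor φ).toCatHom.toFunctor.Faithful := ⟨by
    rintro ⟨i, x⟩ ⟨_, y⟩ ⟨f⟩ ⟨g⟩ h
    injection h with _ _ _ h
    rw [(φ i).toFunctor.map_injective h]⟩
  have hsurj : Function.Surjective (sigmaFunctor φ).obj := by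
    rintro ⟨i, y⟩
    obtain ⟨x, rfl⟩ := hφ i y
    exact ⟨⟨i, x⟩, rfl⟩
  rw [sigmaMap_eq]
  have hfull' : ((sigmaIso A).hom ≫ (sigmaFunctor φ).toCatHom ≫
      (sigmaIso B).inv).toFunctor.Full := by
    rw [Cat.Hom.comp_toFunctor, Cat.Hom.comp_toFunctor]
    infer_instance
  have hfaithful' : ((sigmaIso A).hom ≫ (sigmaFunctor φ).toCatHom ≫
      (sigmaIso B).inv).toFunctor.Faithful := by
    rw [Cat.Hom.comp_toFunctor, Cat.Hom.comp_toFunctor]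
    infer_instance
  refine trivialFibrations_of_surjective _ ?_
  exact (bijective_obj_of_isIso (sigmaIso B).inv).2.comp (hsurj.comp
    (bijective_obj_of_isIso (sigmaIso A).hom).2)

/-! ### Points and intervals -/

lemma exists_terminal_eq : ∃ t : (⊤_ Cat.{u, u} : Cat.{u, u}), ∀ t', t' = t := by
  let e : ⊤_ Cat.{u, u} ≅ Cat.of (Discrete PUnit.{u + 1}) :=
    terminalIsTerminal.uniqueUpToIso Cat.isTerminalDiscretePUnit
  have h := bijective_obj_of_isIso e.hom
  obtain ⟨t, -⟩ := h.2 ⟨⟨⟩⟩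
  exact ⟨t, fun t' => h.1 (Subsingleton.elim (α := Discrete PUnit) _ _)⟩

lemma terminal_map_eq {s t : (⊤_ Cat.{u, u} : Cat.{u, u})} (f g : s ⟶ t) : f = g := by
  let e : ⊤_ Cat.{u, u} ≅ Cat.of (Discrete PUnit.{u + 1}) :=
    terminalIsTerminal.uniqueUpToIso Cat.isTerminalDiscretePUnit
  have : e.hom.toFunctor.IsEquivalence := weakEquivalences_of_isIso e.hom
  have h {a b : Discrete PUnit.{u + 1}} (p q : a ⟶ b) : p = q := Subsingleton.elim _ _
  exact e.hom.toFunctor.map_injective (h _ _)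

lemma terminal_hom_ext {X : Cat.{u, u}} {F G : ⊤_ Cat.{u, u} ⟶ X}
    (h : ∀ t, F.toFunctor.obj t = G.toFunctor.obj t) : F = G := by
  refine Cat.ext (CategoryTheory.Functor.ext h fun s t f => ?_)
  obtain ⟨t₀, ht₀⟩ := exists_terminal_eq.{u}
  obtain rfl := (ht₀ s).trans (ht₀ t).symm
  obtain rfl : f = 𝟙 _ := terminal_map_eq _ _
  simp

/-- The morphism from the terminal category given by an object. -/
noncomputable def point {X : Cat.{u, u}} (x : X) : ⊤_ Cat.{u, u} ⟶ X :=
  ((Functor.const _).obj x).toCatHom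

lemma point_comp {X Y : Cat.{u, u}} (x : X) (F : X ⟶ Y) :
    point x ≫ F = point (F.toFunctor.obj x) :=
  terminal_hom_ext fun _ => rfl

/-- The category with two objects and exactly one morphism between any two objects. -/
def interval : Cat.{u, u} := indiscrete (ULift.{u} Bool)

/-- The left endpoint of the interval. -/
def left : interval.{u} := ULift.up false

/-- The right endpoint of the interval. -/
def right : interval.{u} := ULift.up true

/-- The morphism from the left endpoint of the interval to the right one. -/
def path : left.{u} ⟶ right := PUnit.unit

/-- The morphism from the interval given by an isomorphism. -/
def fromIso {X : Cat.{u, u}} {x y : X} (e : x ≅ y) : interval ⟶ X where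
  toFunctor :=
    { obj
        | ⟨false⟩ => x
        | ⟨true⟩ => y
      map {a b} _ := match a, b with
        | ⟨false⟩, ⟨false⟩ => 𝟙 x
        | ⟨false⟩, ⟨true⟩ => e.hom
        | ⟨true⟩, ⟨false⟩ => e.inv
        | ⟨true⟩, ⟨true⟩ => 𝟙 y
      map_id := by rintro ⟨_ | _⟩ <;> rfl
      map_comp := by rintro ⟨_ | _⟩ ⟨_ | _⟩ ⟨_ | _⟩ _ _ <;> simp }

lemma fromIso_comp {X Y : Cat.{u, u}} {x y : X} (e : x ≅ y) (F : X ⟶ Y) :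
    fromIso e ≫ F = fromIso (F.toFunctor.mapIso e) := by
  refine Cat.ext (Functor.hext ?_ ?_)
  · rintro ⟨_ | _⟩ <;> rfl
  · rintro ⟨_ | _⟩ ⟨_ | _⟩ f
    · exact heq_of_eq (F.toFunctor.map_id x)
    · rfl
    · rfl
    · exact heq_of_eq (F.toFunctor.map_id y)

lemma fromIso_injective {X : Cat.{u, u}} {x y : X} {e e' : x ≅ y}
    (h : fromIso e = fromIso e') : e.hom = e'.hom := by
  have := Functor.congr_hom (congrArg Cat.Hom.toFunctor h) path
  exact this.trans ((Category.id_comp _).trans (Category.comp_id _))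

instance : (terminal.from interval.{u}).toFunctor.Full :=
  ⟨fun _ => ⟨PUnit.unit, terminal_map_eq _ _⟩⟩

instance : (terminal.from interval.{u}).toFunctor.Faithful := ⟨fun _ => rfl⟩

lemma surjective_interval_terminal :
    Function.Surjective (terminal.from interval.{u}).toFunctor.obj := by
  intro t
  obtain ⟨t₀, ht₀⟩ := exists_terminal_eq.{u}
  exact ⟨left, (ht₀ _).trans (ht₀ t).symm⟩

/-- The inclusion of the two endpoints of the interval. -/
noncomputable def endpoints : (⊤_ Cat.{u, u}) ⨿ (⊤_ Cat.{u, u}) ⟶ interval :=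
  coprod.desc (point left) (point right)

lemma bijective_endpoints : Function.Bijective endpoints.{u}.toFunctor.obj := by
  obtain ⟨t, ht⟩ := exists_terminal_eq.{u}
  have hl (s) : endpoints.toFunctor.obj
      ((coprod.inl : _ ⟶ (⊤_ Cat.{u, u}) ⨿ (⊤_ Cat.{u, u})).toFunctor.obj s) = left :=
    Functor.congr_obj (congrArg Cat.Hom.toFunctor
      (coprod.inl_desc (point left) (point right))) s
  have hr (s) : endpoints.toFunctor.obj
      ((coprod.inr : _ ⟶ (⊤_ Cat.{u, u}) ⨿ (⊤_ Cat.{u, u})).toFunctor.obj s) = right :=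
    Functor.congr_obj (congrArg Cat.Hom.toFunctor
      (coprod.inr_desc (point left) (point right))) s
  have hne : left.{u} ≠ right := fun h => Bool.false_ne_true (congrArg ULift.down h)
  constructor
  · intro x y h
    obtain ⟨x, rfl⟩ | ⟨x, rfl⟩ := exists_coprod_obj x <;>
      obtain ⟨y, rfl⟩ | ⟨y, rfl⟩ := exists_coprod_obj y
    · rw [ht x, ht y]
    · rw [hl, hr] at h
      exact absurd h hne
    · rw [hl, hr] at h
      exact absurd h.symm hne
    · rw [ht x, ht y]
  · rintro ⟨_ | _⟩
    · exact ⟨_, hl t⟩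
    · exact ⟨_, hr t⟩

lemma endpoints_comp_fromIso {X : Cat.{u, u}} {x y : X} (e : x ≅ y) :
    endpoints ≫ fromIso e = coprod.desc (point x) (point y) := by
  rw [endpoints, coprod.desc_comp, point_comp, point_comp]
  rfl

/-- A groupoid with two objects which is a `1`-sphere: the double of the interval along its
endpoints. -/
noncomputable def circle : Cat.{u, u} := pushout endpoints.{u} endpoints

lemma isSphere_zero : IsSphere 0 ((⊤_ Cat.{u, u}) ⨿ (⊤_ Cat.{u, u})) :=
  ⟨Iso.refl _⟩

/-- The inclusion of the first half of the circle. -/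
noncomputable def circleInl : interval.{u} ⟶ circle := pushout.inl _ _

/-- The inclusion of the second half of the circle. -/
noncomputable def circleInr : interval.{u} ⟶ circle := pushout.inr _ _

lemma isPushout_circle : IsPushout endpoints.{u} endpoints circleInl circleInr :=
  IsPushout.of_hasPushout _ _

/-- The 0-sphere needs no replacement, and both copies of the terminal category are replaced by the
interval, with the endpoints as cofibrations. -/
lemma isSphere_circle : IsSphere 1 circle.{u} := by
  have hp := trivialFibrations_of_surjective (terminal.from interval.{u})
    surjective_interval_terminal
  exact ⟨_, ⟨Iso.refl _⟩, _, _, _, endpoints, endpoints, 𝟙 _, terminal.from _, terminal.from _,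
    circleInl, circleInr, terminal.hom_ext _ _, terminal.hom_ext _ _,
    trivialFibrations_of_isIso _, hp, hp, bijective_endpoints.1, bijective_endpoints.1,
    isCofibrant _, isPushout_circle⟩

/-- The morphism from the circle that identifies its two halves. -/
noncomputable def fold : circle.{u} ⟶ interval :=
  isPushout_circle.desc (𝟙 _) (𝟙 _) rfl

lemma circleInl_fold : circleInl.{u} ≫ fold = 𝟙 _ := isPushout_circle.inl_desc _ _ _

lemma circleInr_fold : circleInr.{u} ≫ fold = 𝟙 _ := isPushout_circle.inr_desc _ _ _

/-- `fold` is a left inverse of `circleInl`, which is surjective on objects as a pushout of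
`endpoints`. Hence `fold` is a cofibration, and the interval can serve as the disk bounded by the
circle. -/
lemma injective_fold : Function.Injective fold.{u}.toFunctor.obj := by
  have h : Function.LeftInverse fold.{u}.toFunctor.obj circleInl.toFunctor.obj :=
    fun x => Functor.congr_obj (congrArg Cat.Hom.toFunctor circleInl_fold) x
  exact (h.rightInverse_of_surjective
    (surjective_of_isPushout isPushout_circle bijective_endpoints.2)).injective

instance : IsSplitEpi fold.{u} := ⟨⟨⟨circleInl, circleInl_fold⟩⟩⟩

/-! ### Attaching cells -/

/-- The coproduct of intervals is the intermediate object of the required factorization, since the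
interval maps to the terminal category by an acyclic fibration. -/
lemma attachesCells_of_isPushout {n : ℕ} {S : Cat.{u, u}} (hS : IsSphere n S) {φ : S ⟶ interval}
    (hφ : Function.Injective φ.toFunctor.obj) {I : Type u} {X Y : Cat.{u, u}}
    {f : (∐ fun _ : I => S) ⟶ Y} {ι : Y ⟶ X} {j : (∐ fun _ : I => interval) ⟶ X}
    (sq : IsPushout f (Limits.Sigma.map fun _ : I => φ) ι j) : AttachesCells n ι := by
  refine ⟨I, fun _ => S, f, fun _ => hS, isCofibrant _, _, _,
    Limits.Sigma.map fun _ => terminal.from interval.{u}, j, ?_,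
    injective_obj_sigmaMap _ fun _ => hφ,
    trivialFibrations_sigmaMap _ fun _ => surjective_interval_terminal, sq⟩
  refine Sigma.hom_ext _ _ fun i => ?_
  rw [Sigma.ι_map_assoc, Sigma.ι_map, Sigma.ι_map, ← Category.assoc, terminal.comp_from]

/-- The index set of cells is empty. This supplies the constant tail of the skeletal sequence in
every dimension. -/
lemma attachesCells_of_isIso (n : ℕ) {X Y : Cat.{u, u}} (F : X ⟶ Y) [IsIso F] :
    AttachesCells n F := by
  let S : PEmpty.{u + 1} → Cat.{u, u} := PEmpty.elim
  have h (i : PEmpty.{u + 1}) : IsIso (terminal.from (S i)) := i.elim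
  exact ⟨PEmpty, S, Sigma.desc fun i => i.elim, fun i => i.elim, isCofibrant _, _, 𝟙 _,
    Limits.Sigma.map fun i => terminal.from (S i), Sigma.desc fun i => i.elim, Category.id_comp _,
    Function.injective_id, trivialFibrations_of_isIso _,
    IsPushout.of_vert_isIso ⟨Sigma.hom_ext _ _ fun i => i.elim⟩⟩

/-! ### Full functors that are bijective on objects -/

lemma epi_of_full_of_surjective {X Y : Cat.{u, u}} (F : X ⟶ Y) [F.toFunctor.Full]
    (hF : Function.Surjective F.toFunctor.obj) : Epi F where
  left_cancellation {Z} G H h := by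
    replace h := congrArg Cat.Hom.toFunctor h
    refine Cat.ext (Functor.hext (fun y => ?_) fun y y' f => ?_)
    · obtain ⟨x, rfl⟩ := hF y
      exact Functor.congr_obj h x
    · obtain ⟨x, rfl⟩ := hF y
      obtain ⟨x', rfl⟩ := hF y'
      obtain ⟨f, rfl⟩ := F.toFunctor.map_surjective f
      exact Functor.hcongr_hom h f

/-- A functor factors through a full functor bijective on objects if it identifies all the pairs
of parallel morphisms that the latter identifies. -/
lemma exists_fac_of_full_of_bijective {X Y Z : Cat.{u, u}} (F : X ⟶ Y) [F.toFunctor.Full]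
    (hF : Function.Bijective F.toFunctor.obj) (H : X ⟶ Z)
    (h : ∀ {x y : X} (p q : x ⟶ y), F.toFunctor.map p = F.toFunctor.map q →
      H.toFunctor.map p = H.toFunctor.map q) : ∃ G : Y ⟶ Z, F ≫ G = H := by
  choose s hs using hF.2
  choose lift hlift using fun {x y : X} (f : F.toFunctor.obj x ⟶ F.toFunctor.obj y) =>
    F.toFunctor.map_surjective f
  -- The chosen lifts need not respect identities or composition, but `h` makes `H` blind to the
  -- choice of lift.
  let G : Y ⥤ Z :=
    { obj y := H.toFunctor.obj (s y)
      map {y y'} f := H.toFunctor.map (lift (eqToHom (hs y) ≫ f ≫ eqToHom (hs y').symm))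
      map_id y := by
        rw [← H.toFunctor.map_id]
        exact h _ _ (by simp [hlift])
      map_comp f g := by
        rw [← H.toFunctor.map_comp]
        exact h _ _ (by simp [hlift]) }
  have hsF (x : X) : s (F.toFunctor.obj x) = x := hF.1 (hs _)
  refine ⟨G.toCatHom, Cat.ext (CategoryTheory.Functor.ext
    (fun x => congrArg H.toFunctor.obj (hsF x)) fun x y f => ?_)⟩
  have key : H.toFunctor.map (lift (eqToHom (hs _) ≫ F.toFunctor.map f ≫ eqToHom (hs _).symm)) =
      H.toFunctor.map (eqToHom (hsF x) ≫ f ≫ eqToHom (hsF y).symm) :=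
    h _ _ (by simp [hlift, eqToHom_map])
  refine key.trans ?_
  simp [eqToHom_map]

/-- A full functor between groupoids that is bijective on objects attaches `2`-cells, one for each
pair of parallel morphisms that it identifies. -/
lemma attachesCells_of_full_of_bijective {X Y : Cat.{u, u}} (hX : IsGroupoid X) (F : X ⟶ Y)
    [F.toFunctor.Full] (hF : Function.Bijective F.toFunctor.obj) : AttachesCells 1 F := by
  let I : Type u := Σ (x y : X), { p : (x ⟶ y) × (x ⟶ y) //
    F.toFunctor.map p.1 = F.toFunctor.map p.2 }
  let fst (i : I) : i.1 ≅ i.2.1 := asIso i.2.2.1.1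
  let snd (i : I) : i.1 ≅ i.2.1 := asIso i.2.2.1.2
  have hfs (i : I) : fromIso (fst i) ≫ F = fromIso (snd i) ≫ F := by
    rw [fromIso_comp, fromIso_comp]
    exact congrArg fromIso (Iso.ext i.2.2.2)
  -- Two parallel isomorphisms agree on the endpoints, so they glue to an attaching map on the
  -- circle.
  let pair (i : I) : circle ⟶ X := isPushout_circle.desc (fromIso (fst i)) (fromIso (snd i))
    ((endpoints_comp_fromIso _).trans (endpoints_comp_fromIso _).symm)
  have hpl (i : I) : circleInl ≫ pair i = fromIso (fst i) := isPushout_circle.inl_desc _ _ _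
  have hpr (i : I) : circleInr ≫ pair i = fromIso (snd i) := isPushout_circle.inr_desc _ _ _
  have hepi : Epi F := epi_of_full_of_surjective F hF.2
  have sq : Sigma.desc pair ≫ F = (Limits.Sigma.map fun _ : I => fold) ≫
      Sigma.desc fun i => fromIso (fst i) ≫ F := by
    refine Sigma.hom_ext _ _ fun i => ?_
    rw [Sigma.ι_desc_assoc, Sigma.ι_map_assoc, Sigma.ι_desc]
    apply isPushout_circle.hom_ext
    · rw [reassoc_of% hpl i, reassoc_of% circleInl_fold]
    · rw [reassoc_of% hpr i, reassoc_of% circleInr_fold, hfs]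
  -- Since `fold` is a split epimorphism, the second leg of any cocone is determined by the first,
  -- and only the factorization of `s.inl` through `F` needs proof.
  have hepi' : Epi (Limits.Sigma.map fun _ : I => fold.{u}) := inferInstance
  have hdesc (s : PushoutCocone (Sigma.desc pair) (Limits.Sigma.map fun _ : I => fold)) :
      ∃ G : Y ⟶ s.pt, F ≫ G = s.inl := by
    refine exists_fac_of_full_of_bijective F hF s.inl fun {x y} p q hpq => ?_
    let i : I := ⟨x, y, (p, q), hpq⟩
    -- The cocone condition on the cell `i` makes both halves of the circle have the same image, so
    -- `s.inl` equates `p` and `q`.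
    have hi : pair i ≫ s.inl = fold ≫ Sigma.ι (fun _ : I => interval) i ≫ s.inr := by
      have := Sigma.ι (fun _ : I => circle) i ≫= s.condition
      rwa [Sigma.ι_desc_assoc, Sigma.ι_map_assoc] at this
    have hfst : fromIso (fst i) ≫ s.inl = Sigma.ι (fun _ : I => interval) i ≫ s.inr := by
      rw [← hpl, Category.assoc, hi, reassoc_of% circleInl_fold]
    have hsnd : fromIso (snd i) ≫ s.inl = Sigma.ι (fun _ : I => interval) i ≫ s.inr := by
      rw [← hpr, Category.assoc, hi, reassoc_of% circleInr_fold]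
    have h := hfst.trans hsnd.symm
    rw [fromIso_comp, fromIso_comp] at h
    exact fromIso_injective h
  choose desc hdesc using hdesc
  refine attachesCells_of_isPushout isSphere_circle injective_fold
    ⟨⟨sq⟩, ⟨PushoutCocone.IsColimit.mk sq desc hdesc (fun s => ?_) fun s m hm _ => ?_⟩⟩
  · rw [← cancel_epi (Limits.Sigma.map fun _ : I => fold.{u}), ← reassoc_of% sq, hdesc,
      s.condition]
  · rw [← cancel_epi F, hm, hdesc]

/-- A groupoid is the image of the groupoid freely generated by its morphisms under a full functor
that is bijective on objects. -/
lemma exists_attachesCells_full_bijective {G : Cat.{u, u}} (hG : IsGroupoid G) :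
    ∃ (Y X : Cat.{u, u}) (ι : Y ⟶ X) (F : X ⟶ G), IsCWComplexOfDim 0 Y ∧ AttachesCells 0 ι ∧
      F.toFunctor.Full ∧ Function.Bijective F.toFunctor.obj := by
  let I : Type u := Σ (x y : G), x ⟶ y
  let Y : Cat.{u, u} := ∐ fun _ : G => ⊤_ Cat.{u, u}
  let f : (∐ fun _ : I => (⊤_ Cat.{u, u}) ⨿ (⊤_ Cat.{u, u})) ⟶ Y :=
    Sigma.desc fun i => coprod.desc (Sigma.ι (fun _ : G => ⊤_ Cat.{u, u}) i.1)
      (Sigma.ι (fun _ : G => ⊤_ Cat.{u, u}) i.2.1)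
  let φ : Y ⟶ G := Sigma.desc point
  let ψ : (∐ fun _ : I => interval) ⟶ G := Sigma.desc fun i => fromIso (asIso i.2.2)
  have w : f ≫ φ = (Limits.Sigma.map fun _ : I => endpoints) ≫ ψ := by
    refine Sigma.hom_ext _ _ fun i => ?_
    rw [Sigma.ι_desc_assoc, Sigma.ι_map_assoc, Sigma.ι_desc, coprod.desc_comp, Sigma.ι_desc,
      Sigma.ι_desc, endpoints_comp_fromIso]
  have sq := IsPushout.of_hasPushout f (Limits.Sigma.map fun _ : I => endpoints)
  let F := sq.desc φ ψ w
  have hφ : pushout.inl _ _ ≫ F = φ := sq.inl_desc _ _ _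
  have hψ : pushout.inr _ _ ≫ F = ψ := sq.inr_desc _ _ _
  have hι (x : G) (t) :
      φ.toFunctor.obj ((Sigma.ι (fun _ : G => ⊤_ Cat.{u, u}) x).toFunctor.obj t) = x :=
    Functor.congr_obj (congrArg Cat.Hom.toFunctor (Sigma.ι_desc (fun x : G => point x) x)) t
  obtain ⟨t, ht⟩ := exists_terminal_eq.{u}
  have hφ_bij : Function.Bijective φ.toFunctor.obj := by
    refine ⟨fun a b hab => ?_, fun x => ⟨_, hι x t⟩⟩
    obtain ⟨x, s, rfl⟩ := exists_sigma_obj a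
    obtain ⟨y, s', rfl⟩ := exists_sigma_obj b
    rw [hι, hι] at hab
    rw [ht s, ht s', hab]
  have hg : Function.Surjective
      (Limits.Sigma.map fun _ : I => endpoints.{u}).toFunctor.obj := by
    intro z
    obtain ⟨i, y, rfl⟩ := exists_sigma_obj z
    obtain ⟨x, rfl⟩ := bijective_endpoints.2 y
    refine ⟨(Sigma.ι (fun _ : I => (⊤_ Cat.{u, u}) ⨿ (⊤_ Cat.{u, u})) i).toFunctor.obj x, ?_⟩
    exact Functor.congr_obj (congrArg Cat.Hom.toFunctor
      (Sigma.ι_map (fun _ : I => endpoints.{u}) i)) x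
  have hF_comp : F.toFunctor.obj ∘ (pushout.inl f _).toFunctor.obj = φ.toFunctor.obj :=
    congrArg (fun H : Y ⟶ G => H.toFunctor.obj) hφ
  -- Attaching 1-cells adds no objects: the inclusion of `Y` is surjective on objects, as a pushout
  -- of such a map, and injective because its composite `φ` with `F` is.
  have hF : Function.Bijective F.toFunctor.obj := by
    rw [← hF_comp] at hφ_bij
    exact (Function.Bijective.of_comp_iff _
      ⟨hφ_bij.1.of_comp, surjective_of_isPushout sq hg⟩).1 hφ_bij
  refine ⟨Y, _, pushout.inl f _, F, ⟨isCofibrant _, _, ⟨Iso.refl _⟩⟩,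
    attachesCells_of_isPushout isSphere_zero bijective_endpoints.1 sq, ⟨fun {a b} p => ?_⟩, hF⟩
  -- For fullness, the lift of `p` is the 1-cell attached for `p` itself.
  let c : interval ⟶ pushout f (Limits.Sigma.map fun _ : I => endpoints) :=
    Sigma.ι (fun _ : I => interval) ⟨_, _, p⟩ ≫ pushout.inr _ _
  have hc : c ≫ F = fromIso (asIso p) := by
    rw [Category.assoc, hψ, Sigma.ι_desc]
  replace hc := congrArg Cat.Hom.toFunctor hc
  have ha : a = c.toFunctor.obj left := hF.1 (Functor.congr_obj hc left).symm
  have hb : c.toFunctor.obj right = b := hF.1 (Functor.congr_obj hc right)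
  refine ⟨eqToHom ha ≫ c.toFunctor.map path ≫ eqToHom hb, ?_⟩
  have hp : F.toFunctor.map (c.toFunctor.map path) =
      eqToHom (congrArg F.toFunctor.obj ha.symm) ≫ p ≫
        eqToHom (congrArg F.toFunctor.obj hb.symm) := Functor.congr_hom hc path
  rw [Functor.map_comp, Functor.map_comp, eqToHom_map, eqToHom_map, hp]
  simp

/-! ### Groupoids are CW-complexes -/

/-- Every groupoid is the term of index `2` of a sequence of skeleton inclusions that is constant
from there on. -/
lemma exists_sequence {G : Cat.{u, u}} (hG : IsGroupoid G) :
    ∃ F : ℕ ⥤ Cat.{u, u}, F.obj 2 = G ∧ (∀ n, IsCWComplexOfDim n (F.obj n)) ∧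
      (∀ n, AttachesCells n (F.map (homOfLE (Nat.le_succ n)))) ∧
      F.IsEventuallyConstantFrom 2 := by
  obtain ⟨Y, X, ι, φ, hY, hι, hφ, hφ'⟩ := exists_attachesCells_full_bijective hG
  have hX : IsCWComplexOfDim 1 X := ⟨Y, ι, hY, hι⟩
  have hφ_cells : AttachesCells 1 φ :=
    attachesCells_of_full_of_bijective (isGroupoid_of_isCWComplexOfDim hX) φ hφ'
  -- Two steps reach `G`; from index 2 on, identities count as attaching no cells.
  let A : ℕ → Cat.{u, u}
    | 0 => Y
    | 1 => X
    | _ + 2 => G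
  let α : ∀ n, A n ⟶ A (n + 1)
    | 0 => ι
    | 1 => φ
    | _ + 2 => 𝟙 G
  have hα : ∀ n, AttachesCells n (α n)
    | 0 => hι
    | 1 => hφ_cells
    | n + 2 => attachesCells_of_isIso (n + 2) (𝟙 G)
  have hA (n : ℕ) : IsCWComplexOfDim n (A n) := by
    induction n with
    | zero => exact hY
    | succ n ih => exact ⟨_, α n, ih, hα n⟩
  refine ⟨Functor.ofSequence α, rfl, hA, fun n => ?_, ?_⟩
  · rw [Functor.ofSequence_map_homOfLE_succ]
    exact hα n
  · intro n f
    obtain ⟨k, rfl⟩ := Nat.exists_eq_add_of_le (leOfHom f)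
    induction k with
    | zero =>
      obtain rfl : f = 𝟙 _ := Subsingleton.elim _ _
      infer_instance
    | succ k ih =>
      obtain rfl : f = homOfLE (Nat.le_add_right 2 k) ≫ homOfLE (Nat.le_succ (2 + k)) :=
        Subsingleton.elim _ _
      have h : IsIso (α (2 + k)) := by
        rw [Nat.add_comm]
        exact inferInstanceAs (IsIso (𝟙 G))
      have := ih (homOfLE (Nat.le_add_right 2 k))
      rw [Functor.map_comp, Functor.ofSequence_map_homOfLE_succ]
      exact IsIso.comp_isIso' this h

lemma isGroupoid_of_cwComplexes {X : Cat.{u, u}} (h : cwComplexes Cat.{u, u} X) :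
    IsGroupoid X := by
  obtain ⟨-, F, hF, -, h⟩ := h
  exact (isGroupoid_iff_of_weaklyEquivalent h).2
    (isGroupoid_of_isColimit (colimit.isColimit F) fun n => isGroupoid_of_isCWComplexOfDim (hF n))

lemma cwComplexes_of_isGroupoid {G : Cat.{u, u}} (hG : IsGroupoid G) :
    cwComplexes Cat.{u, u} G := by
  obtain ⟨F, rfl, hF, hF', hconst⟩ := exists_sequence hG
  -- The sequence is constant from index 2 on, so the inclusion of that term into the colimit is an
  -- isomorphism and gives a one-step zigzag.
  have := hconst.isIso_ι_of_isColimit (colimit.isColimit F)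
  exact ⟨isCofibrant _, F, hF, hF', .rel _ _
    ⟨(colimit.cocone F).ι.app 2, weakEquivalences_of_isIso _⟩⟩

lemma finiteDimCWComplexes_of_isGroupoid {G : Cat.{u, u}} (hG : IsGroupoid G) :
    finiteDimCWComplexes Cat.{u, u} G := by
  obtain ⟨F, rfl, hF, -⟩ := exists_sequence hG
  exact ⟨2, hF 2⟩

end ModelCW.SmCat

theorem mainTheorem9 :
    ModelCW.finiteDimCWComplexes Cat.{u, u} = ModelCW.groupoids.{u} ∧
    ModelCW.finiteDimCWTypes Cat.{u, u} = ModelCW.groupoids.{u} ∧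
    ModelCW.cwComplexes Cat.{u, u} = ModelCW.groupoids.{u} := by
  refine ⟨funext fun X => propext ⟨?_, ModelCW.SmCat.finiteDimCWComplexes_of_isGroupoid⟩,
    funext fun X => propext ⟨?_, fun h => ⟨X,
      ModelCW.SmCat.finiteDimCWComplexes_of_isGroupoid h, .refl X⟩⟩,
    funext fun X => propext ⟨ModelCW.SmCat.isGroupoid_of_cwComplexes,
      ModelCW.SmCat.cwComplexes_of_isGroupoid⟩⟩
  · rintro ⟨n, h⟩
    exact ModelCW.SmCat.isGroupoid_of_isCWComplexOfDim h
  · rintro ⟨Y, ⟨n, hY⟩, h⟩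
    exact (ModelCW.SmCat.isGroupoid_iff_of_weaklyEquivalent h).2
      (ModelCW.SmCat.isGroupoid_of_isCWComplexOfDim hY)
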